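/- Let $X$ be the multiplication operator $(Xf)(x)=x f(x)$ on $L^2(\mathbb{R},\mathbb{C})$ with domain $\{f\in L^2 : \int_{\mathbb{R}} x^2|f(x)|^2\,dx<\infty\}$, and let $X^3$ be its cube on the natural domain $\{f\in\operatorname{dom}X : Xf\in\operatorname{dom}X,\ X^2f\in\operatorname{dom}X\}$. Let $\Phi(x)=\pi^{-1/4}e^{-x^2/2}$. For a self-adjoint operator $A$ on $L^2(\mathbb{R},\mathbb{C})$ let $e^{itA}$, $t\in\mathbb{R}$, denote the strongly continuous one-parameter unitary group generated by $A$; the characteristic function of $A$ in the state $\Phi$ is $t\mapsto\langle \Phi,e^{itA}\Phi\rangle$. For real $\nu$ and $z>0$ let $K_\nu(z)=\int_0^\infty e^{-z\cosh s}\cosh(\nu s)\,ds$ be the modified Bessel function of the second kind. Then $X$ and $X^3$ are self-adjoint (so that $e^{itX}$ and $e^{itX^3}$ exist), $\Phi$ is a unit vector, $X$ is $\mathcal{N}(0,1/2)$-distributed in the state $\Phi$, i.e. $\langle\Phi,e^{itX}\Phi\rangle$ is the characteristic function $e^{-t^2/4}$ of $\mathcal{N}(0,1/2)$, and for every $t\in\mathbb{R}$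 $$\langle \Phi,e^{itX^3}\Phi\rangle=\frac{1}{\sqrt{\pi}}\int_{\mathbb{R}}e^{itx^3-x^2}\,dx=\begin{cases}\dfrac{2}{3|t|\sqrt{3\pi}}\,e^{\frac{2}{27t^2}}\,K_{1/3}\!\left(\dfrac{2}{27t^2}\right), & t\neq 0,\\[2mm] 1, & t=0.\end{cases}$$ -/

import Mathlib

open MeasureTheory

/-- The Hilbert space `L²(ℝ, ℂ)` with Lebesgue measure; `inner ℂ f g = ∫ conj (f x) * g x dx`. -/
abbrev L2R : Type := Lp ℂ 2 (volume : Measure ℝ)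

/-- The multiplication operator `(X f)(x) = x f(x)` on `L²(ℝ, ℂ)`, with its maximal domain
`{f ∈ L² : x ↦ x f(x) is in L²}`, that is `∫ x² |f(x)|² dx < ∞`. -/
noncomputable def positionOp : L2R →ₗ.[ℂ] L2R where
  domain :=
    { carrier := {f | MemLp (fun x : ℝ => (x : ℂ) * f x) 2 volume}
      add_mem' := by
        intro f g hf hg
        refine (memLp_congr_ae ?_).mp (MemLp.add hf hg)
        filter_upwards [Lp.coeFn_add f g] with x hx
        have hx' : (f + g : L2R) x = f x + g x := hx
        rw [hx', mul_add]
        rfl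
      zero_mem' := by
        refine (memLp_congr_ae ?_).mp (MemLp.zero (ε := ℂ))
        filter_upwards [Lp.coeFn_zero ℂ 2 (volume : Measure ℝ)] with x hx
        have hx' : (0 : L2R) x = 0 := hx
        rw [hx', mul_zero]
        rfl
      smul_mem' := by
        intro c f hf
        refine (memLp_congr_ae ?_).mp (MemLp.const_smul hf c)
        filter_upwards [Lp.coeFn_smul c f] with x hx
        simp [hx, mul_left_comm] }
  toFun :=
    { toFun := fun f => MemLp.toLp (fun x : ℝ => (x : ℂ) * (f : L2R) x) f.2
      map_add' := by
        intro f g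
        rw [← MemLp.toLp_add, MemLp.toLp_eq_toLp_iff]
        filter_upwards [Lp.coeFn_add (f : L2R) (g : L2R)] with x hx
        have hx' : (f + g : L2R) x = (f : L2R) x + (g : L2R) x := hx
        exact (congrArg (fun y => (x : ℂ) * y) hx').trans (mul_add _ _ _)
      map_smul' := by
        intro c f
        rw [RingHom.id_apply, ← MemLp.toLp_const_smul, MemLp.toLp_eq_toLp_iff]
        filter_upwards [Lp.coeFn_smul c (f : L2R)] with x hx
        simp [hx, mul_left_comm] }

section Operators

variable {H : Type*} [NormedAddCommGroup H] [InnerProductSpace ℂ H]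

/-- The product `S T` of two unbounded operators, on its natural domain
`{f ∈ dom T : T f ∈ dom S}`. -/
def opMul (S T : H →ₗ.[ℂ] H) : H →ₗ.[ℂ] H where
  domain :=
    { carrier := {f | ∃ h : f ∈ T.domain, T ⟨f, h⟩ ∈ S.domain}
      add_mem' := by
        rintro f g ⟨hf, hf'⟩ ⟨hg, hg'⟩
        refine ⟨T.domain.add_mem hf hg, ?_⟩
        have := S.domain.add_mem hf' hg'
        rwa [← LinearPMap.map_add] at this
      zero_mem' := by
        refine ⟨T.domain.zero_mem, ?_⟩
        have h : T ⟨0, T.domain.zero_mem⟩ = 0 := LinearPMap.map_zero T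
        rw [h]
        exact S.domain.zero_mem
      smul_mem' := by
        rintro c f ⟨hf, hf'⟩
        refine ⟨T.domain.smul_mem c hf, ?_⟩
        have := S.domain.smul_mem c hf'
        rwa [← LinearPMap.map_smul] at this }
  toFun :=
    { toFun := fun f => S ⟨T ⟨f, f.2.1⟩, f.2.2⟩
      map_add' := by
        intro f g
        rw [← LinearPMap.map_add]
        congr 1
        ext
        exact LinearPMap.map_add T ⟨f, f.2.1⟩ ⟨g, g.2.1⟩
      map_smul' := by
        intro c f
        rw [RingHom.id_apply, ← LinearPMap.map_smul]
        congr 1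
        ext
        exact LinearPMap.map_smul T c ⟨f, f.2.1⟩ }

/-- The cube `A³ = A (A A)` of an unbounded operator, on its natural domain. -/
def opCube (A : H →ₗ.[ℂ] H) : H →ₗ.[ℂ] H := opMul A (opMul A A)

variable [CompleteSpace H]

/-- `U` is the strongly continuous one-parameter unitary group `t ↦ e^{itA}` generated by `A`:
the limit `lim_{t → 0} (U t f - f) / t` exists exactly for `f ∈ dom A`, and then equals `i A f`. -/
structure IsUnitaryGroupOf (U : ℝ → H →L[ℂ] H) (A : H →ₗ.[ℂ] H) : Prop where
  unitary : ∀ t, U t ∈ unitary (H →L[ℂ] H)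
  map_zero : U 0 = 1
  map_add : ∀ s t, U (s + t) = U s * U t
  continuous : ∀ f, Continuous fun t => U t f
  hasDerivAt_iff : ∀ f g, HasDerivAt (fun t => U t f) (Complex.I • g) 0 ↔ (f, g) ∈ A.graph

/-! The unitary group generated by a densely defined operator is unique. -/

theorem IsUnitaryGroupOf.hasDerivAt {U : ℝ → H →L[ℂ] H} {A : H →ₗ.[ℂ] H}
    (hU : IsUnitaryGroupOf U A) {f g : H} (h : (f, g) ∈ A.graph) (t : ℝ) :
    HasDerivAt (fun t => U t f) (U t (Complex.I • g)) t := by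
  have h1 : HasDerivAt (fun s => U s f) (Complex.I • g) (t - t) := by
    rw [sub_self]
    exact (hU.hasDerivAt_iff f g).2 h
  have h3 := ((U t).restrictScalars ℝ).hasFDerivAt.comp_hasDerivAt t (h1.comp_sub_const t t)
  refine h3.congr_of_eventuallyEq (Filter.Eventually.of_forall fun s => ?_)
  change U s f = (U t * U (s - t)) f
  rw [← hU.map_add, add_sub_cancel]

theorem IsUnitaryGroupOf.mem_graph {U : ℝ → H →L[ℂ] H} {A : H →ₗ.[ℂ] H}
    (hU : IsUnitaryGroupOf U A) {f g : H} (h : (f, g) ∈ A.graph) (t : ℝ) :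
    (U t f, U t g) ∈ A.graph := by
  rw [← hU.hasDerivAt_iff]
  have h3 := ((U t).restrictScalars ℝ).hasFDerivAt.comp_hasDerivAt 0 ((hU.hasDerivAt_iff f g).2 h)
  have h4 : HasDerivAt (fun s => U t (U s f)) (U t (Complex.I • g)) 0 := h3
  rw [map_smul] at h4
  refine h4.congr_of_eventuallyEq (Filter.Eventually.of_forall fun s => ?_)
  change (U s * U t) f = (U t * U s) f
  rw [← hU.map_add, ← hU.map_add, add_comm]

theorem hasDerivAt_norm_sq {F : ℝ → H} {F' : H} {t : ℝ} (h : HasDerivAt F F' t) :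
    HasDerivAt (fun s => ‖F s‖ ^ 2) (2 * (inner ℂ (F t) F').re) t := by
  let _ : InnerProductSpace ℝ H := InnerProductSpace.rclikeToReal ℂ H
  exact h.norm_sq

theorem IsUnitaryGroupOf.re_inner_eq_zero {U : ℝ → H →L[ℂ] H} {A : H →ₗ.[ℂ] H}
    (hU : IsUnitaryGroupOf U A) {f g : H} (h : (f, g) ∈ A.graph) :
    (inner ℂ f (Complex.I • g)).re = 0 := by
  have h1 := hasDerivAt_norm_sq ((hU.hasDerivAt_iff f g).2 h)
  have h2 : (fun s => ‖U s f‖ ^ 2) = fun _ => ‖f‖ ^ 2 := by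
    ext s
    rw [ContinuousLinearMap.norm_map_of_mem_unitary (hU.unitary s)]
  rw [h2] at h1
  have h3 := h1.unique (hasDerivAt_const _ _)
  rw [hU.map_zero] at h3
  have h4 : (2 : ℝ) * (inner ℂ f (Complex.I • g)).re = 0 := h3
  linarith

theorem IsUnitaryGroupOf.unique {U V : ℝ → H →L[ℂ] H} {A : H →ₗ.[ℂ] H}
    (hU : IsUnitaryGroupOf U A) (hV : IsUnitaryGroupOf V A) (hA : Dense (A.domain : Set H)) :
    U = V := by
  ext t f
  refine congrFun (Continuous.ext_on hA (U t).continuous (V t).continuous ?_) f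
  intro f hf
  have hg := LinearPMap.mem_graph A ⟨f, hf⟩
  set g := A ⟨f, hf⟩
  have key : ∀ t, HasDerivAt (fun s => ‖U s f - V s f‖ ^ 2) 0 t := by
    intro t
    have h1 := hasDerivAt_norm_sq ((hU.hasDerivAt hg t).sub (hV.hasDerivAt hg t))
    have h2 := hU.re_inner_eq_zero (A.graph.sub_mem (hU.mem_graph hg t) (hV.mem_graph hg t))
    rw [map_smul, map_smul, ← smul_sub] at h1
    have h3 : (2 : ℝ) * (inner ℂ (U t f - V t f) (Complex.I • (U t g - V t g))).re = 0 := by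
      rw [show (inner ℂ (U t f - V t f) (Complex.I • (U t g - V t g))).re = 0 from h2, mul_zero]
    rw [← h3]
    exact h1
  have hc := is_const_of_deriv_eq_zero (fun s => (key s).differentiableAt)
    (fun s => (key s).deriv) t 0
  simp only [hU.map_zero, hV.map_zero, sub_self, norm_zero] at hc
  exact sub_eq_zero.1 (norm_eq_zero.1 (pow_eq_zero_iff two_ne_zero |>.1 (hc.trans (by simp))))

open Classical in
/-- `expI A t` is the unitary operator `e^{itA}`, for an unbounded self-adjoint operator `A`.
(A densely defined `A` generates at most one unitary group; if there is none, the value is `1`.) -/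
noncomputable def expI (A : H →ₗ.[ℂ] H) : ℝ → H →L[ℂ] H :=
  if h : ∃ U, IsUnitaryGroupOf U A then h.choose else 1

/-- The characteristic function `t ↦ ⟨Φ, e^{itA} Φ⟩` of the observable `A` in the state `Φ`. -/
noncomputable def opCharFun (A : H →ₗ.[ℂ] H) (Φ : H) (t : ℝ) : ℂ := inner ℂ Φ (expI A t Φ)

end Operators

/-- The Gaussian function `x ↦ π^{-1/4} e^{-x²/2}`. -/
noncomputable def gaussianFun (x : ℝ) : ℂ :=
  ((Real.pi ^ (-(1 / 4) : ℝ) * Real.exp (-x ^ 2 / 2) : ℝ) : ℂ)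

theorem memLp_gaussianFun : MemLp gaussianFun 2 (volume : Measure ℝ) := by
  have hc : Continuous gaussianFun := by
    unfold gaussianFun
    fun_prop
  rw [memLp_two_iff_integrable_sq_norm hc.aestronglyMeasurable]
  have h := (integrable_exp_neg_mul_sq (b := 1) one_pos).const_mul
    ((Real.pi ^ (-(1 / 4) : ℝ)) ^ 2)
  refine h.congr (Filter.Eventually.of_forall fun x => ?_)
  simp only [gaussianFun, Complex.norm_real, Real.norm_eq_abs, sq_abs]
  rw [mul_pow, ← Real.exp_nat_mul]
  congr 2
  push_cast
  ring

/-- The Gaussian state `Φ(x) = π^{-1/4} e^{-x²/2}` as a vector of `L²(ℝ, ℂ)`. -/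
noncomputable def gaussianState : L2R := memLp_gaussianFun.toLp gaussianFun

/-- The modified Bessel function of the second kind `K_ν(z)`, for real order `ν` and real argument
`z > 0`: `K_ν(z) = ∫_0^∞ e^{-z cosh s} cosh (ν s) ds`. -/
noncomputable def besselK (ν z : ℝ) : ℝ :=
  ∫ s in Set.Ioi (0 : ℝ), Real.exp (-z * Real.cosh s) * Real.cosh (ν * s)

/-- The value `(2 / (3 |t| √(3π))) e^{2/(27t²)} K_{1/3}(2/(27t²))` for `t ≠ 0`,
and `1` for `t = 0`. -/
noncomputable def cubeCharFun (t : ℝ) : ℝ :=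
  if t = 0 then 1
  else 2 / (3 * |t| * √(3 * Real.pi)) * Real.exp (2 / (27 * t ^ 2)) *
    besselK (1 / 3) (2 / (27 * t ^ 2))

/-!
Multiplication by a real measurable function `m` on its maximal domain in `L²(μ)` is self-adjoint,
and generates the unitary group of multiplication by `e^{itm}`
(`IsMultiplicationBy.isSelfAdjoint`, `IsMultiplicationBy.isUnitaryGroupOf`). The position operator
and its cube are of this kind, with `m x = x` and `m x = x³`; for the cube one uses that
`|x|, x² ≤ 1 + |x|³`, so that the natural domain is the maximal one. As a densely defined operator
generates at most one group, the characteristic function of such an operator in the Gaussian state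
is `π^{-1/2} ∫ exp (i t m(x) - x²) dx` (`IsMultiplicationBy.opCharFun_gaussianState`).
For `m x = x` this is the characteristic function of `N(0, 1/2)`.

For `m x = x³` and `t > 0` the integral is evaluated by steepest descent. Completing the cube, that
is substituting `w = 2 a sinh θ - i a` with `a = 1 / (3t)`, turns the exponent into
`z (1 + i sinh (3 θ))` with `z = 2 / (27 t²)`. On the line `θ = s + i π / 6`, whose image is a branch
of a hyperbola through the saddle point `w = 0`, this is the real number `z (1 - cosh (3 s))`
(`cubic_hyperbola`). Between the real line and the hyperbola the integrand is bounded by a Gaussian,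
so Cauchy's theorem moves the integral to the hyperbola (`integral_cexp_cubic_eq_hyperbola`). There
the odd part of `dw = 2 a cosh (s + i π / 6) ds` integrates to zero, and `u = 3 s` in the even part
gives `K_{1/3}(z)`. The case `t < 0` follows by reflection.
-/

open Filter Topology

/-! ### Multiplication operators and their unitary groups -/

section Multiplication

variable {α : Type*}

/-- The spectral cut-off: the indicator function of `{|m| ≤ n}`. -/
noncomputable def cutoff (m : α → ℝ) (n : ℕ) : α → ℂ := {x | |m x| ≤ n}.indicator 1

theorem norm_cutoff_le (m : α → ℝ) (n : ℕ) (x : α) : ‖cutoff m n x‖ ≤ 1 := by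
  unfold cutoff
  exact (norm_indicator_le_norm_self _ _).trans (by simp)

theorem norm_mul_cutoff_le (m : α → ℝ) (n : ℕ) (x : α) : ‖(m x : ℂ) * cutoff m n x‖ ≤ n := by
  by_cases h : |m x| ≤ n
  · simp [cutoff, Set.indicator, h]
  · simp [cutoff, Set.indicator, h]

theorem cutoff_eventually_eq_one (m : α → ℝ) (x : α) : ∀ᶠ n in atTop, cutoff m n x = 1 := by
  filter_upwards [eventually_ge_atTop ⌈|m x|⌉₊] with n hn
  have : |m x| ≤ n := (Nat.le_ceil _).trans (Nat.cast_le.2 hn)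
  simp [cutoff, Set.indicator, this]

variable [MeasurableSpace α] {μ : Measure α}

/-- Dominated convergence in `L²(μ)`. Pointwise convergence is asked of chosen representatives `φ i`,
since for an uncountable family the exceptional null sets of the classes `F i` could add up. -/
theorem tendsto_zero_of_dominated_L2 {ι : Type*} {l : Filter ι} [l.IsCountablyGenerated]
    {F : ι → Lp ℂ 2 μ} {φ : ι → α → ℂ} (G : Lp ℂ 2 μ) (hF : ∀ i, F i =ᵐ[μ] φ i)
    (hG : ∀ i, ∀ᵐ x ∂μ, ‖φ i x‖ ≤ ‖G x‖) (h0 : ∀ᵐ x ∂μ, Tendsto (φ · x) l (𝓝 0)) :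
    Tendsto F l (𝓝 0) := by
  have hsq : Tendsto (fun i => ‖F i‖ ^ 2) l (𝓝 0) := by
    have hnorm : ∀ i, ‖F i‖ ^ 2 = ∫ x, ‖φ i x‖ ^ 2 ∂μ := by
      intro i
      have h1 : ((‖F i‖ ^ 2 : ℝ) : ℂ) = inner ℂ (F i) (F i) := by
        rw [inner_self_eq_norm_sq_to_K]; norm_cast
      rw [← Complex.ofReal_inj, h1, L2.inner_def, ← integral_complex_ofReal]
      refine integral_congr_ae ?_
      filter_upwards [hF i] with x hx
      rw [hx, inner_self_eq_norm_sq_to_K]; norm_cast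
    simp_rw [hnorm]
    have := tendsto_integral_filter_of_dominated_convergence (μ := μ) (l := l)
      (F := fun i x => ‖φ i x‖ ^ 2) (f := fun _ => (0 : ℝ)) (fun x => ‖G x‖ ^ 2)
      (Eventually.of_forall fun i =>
        (((Lp.aestronglyMeasurable (F i)).congr (hF i)).norm.pow 2))
      (Eventually.of_forall fun i => by
        filter_upwards [hG i] with x hx
        rw [Real.norm_eq_abs, abs_of_nonneg (sq_nonneg _)]
        gcongr)
      ((memLp_two_iff_integrable_sq_norm (Lp.aestronglyMeasurable G)).1 (Lp.memLp G))
      (by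
        filter_upwards [h0] with x hx
        simpa using (hx.norm.pow 2))
    simpa using this
  rw [tendsto_zero_iff_norm_tendsto_zero]
  simpa using hsq.sqrt

theorem memLp_mul_of_bounded {b : α → ℂ} (hb : Measurable b) {C : ℝ} (hC : ∀ x, ‖b x‖ ≤ C)
    (f : Lp ℂ 2 μ) : MemLp (fun x => b x * f x) 2 μ :=
  (Lp.memLp f).of_le_mul (c := C)
    (hb.aestronglyMeasurable.mul (Lp.aestronglyMeasurable f))
    (Eventually.of_forall fun x => by
      rw [norm_mul]; exact mul_le_mul_of_nonneg_right (hC x) (norm_nonneg _))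

/-- Multiplication by a bounded measurable function `b`, as a bounded operator on `L²(μ)`. -/
noncomputable def boundedMul (b : α → ℂ) (hb : Measurable b) (C : ℝ) (hC : ∀ x, ‖b x‖ ≤ C) :
    Lp ℂ 2 μ →L[ℂ] Lp ℂ 2 μ :=
  LinearMap.mkContinuous
    { toFun := fun f => (memLp_mul_of_bounded hb hC f).toLp _
      map_add' := by
        intro f g
        rw [← MemLp.toLp_add, MemLp.toLp_eq_toLp_iff]
        filter_upwards [Lp.coeFn_add f g] with x hx
        have hx' : (f + g) x = f x + g x := hx
        exact (congrArg (b x * ·) hx').trans (mul_add _ _ _)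
      map_smul' := by
        intro c f
        rw [RingHom.id_apply, ← MemLp.toLp_const_smul, MemLp.toLp_eq_toLp_iff]
        filter_upwards [Lp.coeFn_smul c f] with x hx
        simp [hx, mul_left_comm] }
    C (fun f => by
      refine Lp.norm_le_mul_norm_of_ae_le_mul ?_
      filter_upwards [(memLp_mul_of_bounded hb hC f).coeFn_toLp] with x hx
      simp only [LinearMap.coe_mk, AddHom.coe_mk, hx, norm_mul]
      exact mul_le_mul_of_nonneg_right (hC x) (norm_nonneg _))

theorem coeFn_boundedMul (b : α → ℂ) (hb : Measurable b) (C : ℝ) (hC : ∀ x, ‖b x‖ ≤ C)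
    (f : Lp ℂ 2 μ) : boundedMul b hb C hC f =ᵐ[μ] fun x => b x * f x :=
  MemLp.coeFn_toLp (memLp_mul_of_bounded hb hC f)

/-- `A` is the operator of multiplication by the real function `m` on its maximal domain:
`f` lies in the domain exactly when `m f` is in `L²(μ)`, and then `A f = m f`. -/
def IsMultiplicationBy (A : Lp ℂ 2 μ →ₗ.[ℂ] Lp ℂ 2 μ) (m : α → ℝ) : Prop :=
  ∀ f g : Lp ℂ 2 μ, (f, g) ∈ A.graph ↔ g =ᵐ[μ] fun x => (m x : ℂ) * f x

theorem measurable_cutoff {m : α → ℝ} (hm : Measurable m) (n : ℕ) : Measurable (cutoff m n) :=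
  measurable_one.indicator (measurableSet_le hm.abs measurable_const)

/-- Multiplication by `cutoff m n`, which maps `L²(μ)` into the domain of multiplication by `m`. -/
noncomputable def cutoffOp {m : α → ℝ} (hm : Measurable m) (n : ℕ) : Lp ℂ 2 μ →L[ℂ] Lp ℂ 2 μ :=
  boundedMul (cutoff m n) (measurable_cutoff hm n) 1 (norm_cutoff_le m n)

/-- Multiplication by the bounded function `m · cutoff m n`. -/
noncomputable def mulCutoffOp {m : α → ℝ} (hm : Measurable m) (n : ℕ) :
    Lp ℂ 2 μ →L[ℂ] Lp ℂ 2 μ :=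
  boundedMul (fun x => (m x : ℂ) * cutoff m n x)
    ((Complex.measurable_ofReal.comp hm).mul (measurable_cutoff hm n)) n (norm_mul_cutoff_le m n)

theorem tendsto_cutoffOp {m : α → ℝ} (hm : Measurable m) (f : Lp ℂ 2 μ) :
    Tendsto (fun n => cutoffOp hm n f) atTop (𝓝 f) := by
  rw [← tendsto_sub_nhds_zero_iff]
  refine tendsto_zero_of_dominated_L2 (φ := fun n x => (cutoff m n x - 1) * f x) f ?_ ?_ ?_
  · intro n
    filter_upwards [Lp.coeFn_sub (cutoffOp hm n f) f, coeFn_boundedMul (cutoff m n)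
      (measurable_cutoff hm n) 1 (norm_cutoff_le m n) f] with x h1 h2
    rw [h1, Pi.sub_apply, sub_mul, one_mul, ← h2]
    rfl
  · refine fun n => Eventually.of_forall fun x => ?_
    by_cases h : |m x| ≤ n <;> simp [cutoff, Set.indicator, h]
  · refine Eventually.of_forall fun x => ?_
    refine tendsto_const_nhds.congr' ?_
    filter_upwards [cutoff_eventually_eq_one m x] with n hn
    simp [hn]

namespace IsMultiplicationBy

variable {A : Lp ℂ 2 μ →ₗ.[ℂ] Lp ℂ 2 μ} {m : α → ℝ}

theorem cutoffOp_mem_graph (h : IsMultiplicationBy A m) (hm : Measurable m) (n : ℕ)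
    (f : Lp ℂ 2 μ) : (cutoffOp hm n f, mulCutoffOp hm n f) ∈ A.graph := by
  rw [h]
  filter_upwards [coeFn_boundedMul (cutoff m n) (measurable_cutoff hm n) 1
    (norm_cutoff_le m n) f, coeFn_boundedMul (fun x => (m x : ℂ) * cutoff m n x)
    ((Complex.measurable_ofReal.comp hm).mul (measurable_cutoff hm n)) n
    (norm_mul_cutoff_le m n) f] with x h1 h2
  rw [cutoffOp, mulCutoffOp, h1, h2, mul_assoc]

theorem dense_domain (h : IsMultiplicationBy A m) (hm : Measurable m) :
    Dense (A.domain : Set (Lp ℂ 2 μ)) := fun f =>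
  mem_closure_of_tendsto (tendsto_cutoffOp hm f) <| Eventually.of_forall fun n =>
    LinearPMap.mem_domain_of_mem_graph (h.cutoffOp_mem_graph hm n f)

/-- A real multiplication operator on its maximal domain is self-adjoint. -/
theorem isSelfAdjoint (h : IsMultiplicationBy A m) (hm : Measurable m) : IsSelfAdjoint A := by
  rw [LinearPMap.isSelfAdjoint_def]
  refine LinearPMap.eq_of_eq_graph ?_
  rw [LinearPMap.adjoint_graph_eq_graph_adjoint (h.dense_domain hm)]
  ext ⟨f, g⟩
  rw [Submodule.mem_adjoint_iff, h]
  simp only [sub_eq_zero]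
  constructor
  · intro hfg
    -- testing against truncated vectors identifies `g` with `m f` on each `{|m| ≤ n}`
    have hn : ∀ n, mulCutoffOp hm n f = cutoffOp hm n g := by
      intro n
      refine ext_inner_left ℂ fun a => ?_
      have key := hfg _ _ (h.cutoffOp_mem_graph hm n a)
      have e1 : inner ℂ a (mulCutoffOp hm n f) = inner ℂ (mulCutoffOp hm n a) f := by
        rw [L2.inner_def, L2.inner_def]
        refine integral_congr_ae ?_
        filter_upwards [coeFn_boundedMul (fun x => (m x : ℂ) * cutoff m n x)
          ((Complex.measurable_ofReal.comp hm).mul (measurable_cutoff hm n)) n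
          (norm_mul_cutoff_le m n) f, coeFn_boundedMul (fun x => (m x : ℂ) * cutoff m n x)
          ((Complex.measurable_ofReal.comp hm).mul (measurable_cutoff hm n)) n
          (norm_mul_cutoff_le m n) a] with x h1 h2
        rw [mulCutoffOp, h1, h2]
        by_cases hx : |m x| ≤ n <;> simp [cutoff, Set.indicator, hx]; ring
      have e2 : inner ℂ a (cutoffOp hm n g) = inner ℂ (cutoffOp hm n a) g := by
        rw [L2.inner_def, L2.inner_def]
        refine integral_congr_ae ?_
        filter_upwards [coeFn_boundedMul (cutoff m n) (measurable_cutoff hm n) 1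
          (norm_cutoff_le m n) g, coeFn_boundedMul (cutoff m n) (measurable_cutoff hm n) 1
          (norm_cutoff_le m n) a] with x h1 h2
        rw [cutoffOp, h1, h2]
        by_cases hx : |m x| ≤ n <;> simp [cutoff, Set.indicator, hx]
      rw [e1, e2, key]
    have hae : ∀ᵐ x ∂μ, ∀ n, (m x : ℂ) * cutoff m n x * f x = cutoff m n x * g x := by
      rw [ae_all_iff]
      intro n
      have h1 := coeFn_boundedMul (fun x => (m x : ℂ) * cutoff m n x)
        ((Complex.measurable_ofReal.comp hm).mul (measurable_cutoff hm n)) n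
        (norm_mul_cutoff_le m n) f
      have h2 := coeFn_boundedMul (cutoff m n) (measurable_cutoff hm n) 1 (norm_cutoff_le m n) g
      have h3 := hn n
      rw [mulCutoffOp, cutoffOp] at h3
      rw [h3] at h1
      exact h1.symm.trans h2
    filter_upwards [hae] with x hx
    obtain ⟨n, hn⟩ := (cutoff_eventually_eq_one m x).exists
    have := hx n
    rw [hn] at this
    simpa using this.symm
  · intro hg a b hab
    rw [h] at hab
    rw [L2.inner_def, L2.inner_def]
    refine integral_congr_ae ?_
    filter_upwards [hg, hab] with x h1 h2
    rw [h1, h2]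
    simp
    ring

end IsMultiplicationBy

/-- The unitary operator of multiplication by `e^{itm}`. -/
noncomputable def phaseOp {m : α → ℝ} (hm : Measurable m) (t : ℝ) : Lp ℂ 2 μ →L[ℂ] Lp ℂ 2 μ :=
  boundedMul (fun x => Complex.exp ((t * m x : ℝ) * Complex.I))
    (by fun_prop) 1 (fun x => (Complex.norm_exp_ofReal_mul_I _).le)

theorem coeFn_phaseOp {m : α → ℝ} (hm : Measurable m) (t : ℝ) (f : Lp ℂ 2 μ) :
    phaseOp hm t f =ᵐ[μ] fun x => Complex.exp ((t * m x : ℝ) * Complex.I) * f x :=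
  coeFn_boundedMul _ _ _ _ _

theorem phaseOp_zero {m : α → ℝ} (hm : Measurable m) : phaseOp (μ := μ) hm 0 = 1 := by
  ext1 f
  refine Lp.ext ?_
  filter_upwards [coeFn_phaseOp hm 0 f] with x hx
  simp [hx]

theorem phaseOp_add {m : α → ℝ} (hm : Measurable m) (s t : ℝ) :
    phaseOp (μ := μ) hm (s + t) = phaseOp hm s * phaseOp hm t := by
  ext1 f
  refine Lp.ext ?_
  filter_upwards [coeFn_phaseOp hm (s + t) f, coeFn_phaseOp hm t f,
    coeFn_phaseOp hm s (phaseOp hm t f)] with x h1 h2 h3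
  rw [h1, mul_apply_eq_comp, h3, h2, ← mul_assoc, ← Complex.exp_add]
  congr 2
  push_cast
  ring

theorem adjoint_phaseOp {m : α → ℝ} (hm : Measurable m) (t : ℝ) :
    ContinuousLinearMap.adjoint (phaseOp (μ := μ) hm t) = phaseOp hm (-t) := by
  symm
  rw [ContinuousLinearMap.eq_adjoint_iff]
  intro f g
  rw [L2.inner_def, L2.inner_def]
  refine integral_congr_ae ?_
  filter_upwards [coeFn_phaseOp hm (-t) f, coeFn_phaseOp hm t g] with x h1 h2
  rw [h1, h2]
  simp [← Complex.exp_conj]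
  ring

theorem phaseOp_mem_unitary {m : α → ℝ} (hm : Measurable m) (t : ℝ) :
    phaseOp (μ := μ) hm t ∈ unitary (Lp ℂ 2 μ →L[ℂ] Lp ℂ 2 μ) := by
  rw [Unitary.mem_iff, ContinuousLinearMap.star_eq_adjoint, adjoint_phaseOp, ← phaseOp_add,
    ← phaseOp_add]
  simp [phaseOp_zero]

theorem continuous_phaseOp {m : α → ℝ} (hm : Measurable m) (f : Lp ℂ 2 μ) :
    Continuous fun t => phaseOp hm t f := by
  rw [continuous_iff_continuousAt]
  intro t
  rw [ContinuousAt, ← tendsto_sub_nhds_zero_iff]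
  refine tendsto_zero_of_dominated_L2 (φ := fun s x =>
    (Complex.exp ((s * m x : ℝ) * Complex.I) - Complex.exp ((t * m x : ℝ) * Complex.I)) * f x)
    ((2 : ℂ) • f) ?_ ?_ ?_
  · intro s
    filter_upwards [Lp.coeFn_sub (phaseOp hm s f) (phaseOp hm t f), coeFn_phaseOp hm s f,
      coeFn_phaseOp hm t f] with x h1 h2 h3
    rw [h1, Pi.sub_apply, h2, h3, sub_mul]
  · intro s
    filter_upwards [Lp.coeFn_smul (2 : ℂ) f] with x hx
    rw [hx, Pi.smul_apply, norm_smul, norm_mul]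
    gcongr
    refine (norm_sub_le _ _).trans ?_
    rw [Complex.norm_exp_ofReal_mul_I, Complex.norm_exp_ofReal_mul_I]
    norm_num
  · refine Eventually.of_forall fun x => ?_
    have : Continuous fun s : ℝ => (Complex.exp ((s * m x : ℝ) * Complex.I)
      - Complex.exp ((t * m x : ℝ) * Complex.I)) * f x := by fun_prop
    simpa using this.tendsto t

/-- The derivative at `0` as a limit of difference quotients with complex scalars. -/
theorem hasDerivAt_zero_iff_tendsto {H : Type*} [NormedAddCommGroup H] [InnerProductSpace ℂ H]
    {F : ℝ → H} {F' : H} :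
    HasDerivAt F F' 0 ↔ Tendsto (fun t : ℝ => (t : ℂ)⁻¹ • (F t - F 0)) (𝓝[≠] 0) (𝓝 F') := by
  rw [hasDerivAt_iff_tendsto_slope_zero]
  refine tendsto_congr fun t => ?_
  rw [zero_add, ← Complex.ofReal_inv]
  rfl

theorem hasDerivAt_phase (r : ℝ) :
    HasDerivAt (fun t : ℝ => Complex.exp ((t * r : ℝ) * Complex.I)) (Complex.I * r) 0 := by
  have h1 : HasDerivAt (fun t : ℝ => ((t * r : ℝ) * Complex.I : ℂ)) ((1 * r : ℝ) * Complex.I) 0 :=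
    (((hasDerivAt_id (0 : ℝ)).mul_const r).ofReal_comp).mul_const _
  convert h1.cexp using 1
  simp [mul_comm]

theorem norm_phase_sub_one_le (y : ℝ) : ‖Complex.exp (y * Complex.I) - 1‖ ≤ |y| := by
  rw [mul_comm]
  simpa using Real.norm_exp_I_mul_ofReal_sub_one_le (x := y)

/-- Multiplication by `e^{itm}` is the unitary group generated by multiplication by `m`: if `m f` is
in `L²(μ)`, the difference quotients converge by dominated convergence with bound `2 |m f|`;
conversely an `L²(μ)` limit of the quotients agrees with their pointwise limit `i m f`. -/
theorem IsMultiplicationBy.isUnitaryGroupOf {A : Lp ℂ 2 μ →ₗ.[ℂ] Lp ℂ 2 μ} {m : α → ℝ}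
    (h : IsMultiplicationBy A m) (hm : Measurable m) : IsUnitaryGroupOf (phaseOp hm) A where
  unitary := phaseOp_mem_unitary hm
  map_zero := phaseOp_zero hm
  map_add := phaseOp_add hm
  continuous := continuous_phaseOp hm
  hasDerivAt_iff f g := by
    have hslope : ∀ t : ℝ, (t : ℂ)⁻¹ • (phaseOp hm t f - phaseOp hm 0 f) =ᵐ[μ] fun x =>
        (t : ℂ)⁻¹ • (Complex.exp ((t * m x : ℝ) * Complex.I) - 1) * f x := by
      intro t
      filter_upwards [Lp.coeFn_smul (t : ℂ)⁻¹ (phaseOp hm t f - phaseOp hm 0 f),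
        Lp.coeFn_sub (phaseOp hm t f) (phaseOp hm 0 f), coeFn_phaseOp hm t f,
        coeFn_phaseOp hm 0 f] with x h1 h2 h3 h4
      rw [h1, Pi.smul_apply, h2, Pi.sub_apply, h3, h4]
      simp [sub_mul, mul_assoc]
    have hpt : ∀ x, Tendsto (fun t : ℝ => (t : ℂ)⁻¹ • (Complex.exp ((t * m x : ℝ) * Complex.I) - 1) * f x)
        (𝓝[≠] 0) (𝓝 (Complex.I * m x * f x)) := by
      intro x
      have := (hasDerivAt_zero_iff_tendsto.1 (hasDerivAt_phase (m x))).mul_const (f x)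
      simpa using this
    rw [h, hasDerivAt_zero_iff_tendsto]
    constructor
    · intro hd
      have hseq : Tendsto (fun n : ℕ => (1 / ((n : ℝ) + 1))) atTop (𝓝[≠] 0) := by
        refine tendsto_nhdsWithin_iff.2 ⟨tendsto_one_div_add_atTop_nhds_zero_nat, ?_⟩
        exact Eventually.of_forall fun n => (Nat.one_div_pos_of_nat (α := ℝ)).ne'
      -- a subsequence of the difference quotients converges almost everywhere
      obtain ⟨ns, hns, hae⟩ := (tendstoInMeasure_of_tendsto_Lp (hd.comp hseq)).exists_seq_tendsto_ae
      have hall : ∀ᵐ x ∂μ, ∀ n : ℕ, _ := ae_all_iff.2 fun n : ℕ => hslope (1 / ((n : ℝ) + 1))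
      filter_upwards [hae, hall, Lp.coeFn_smul Complex.I g] with x h1 h2 h3
      have h4 := (hpt x).comp (hseq.comp hns.tendsto_atTop)
      have h5 : Tendsto (fun i => (((1 / ((ns i : ℝ) + 1) : ℝ) : ℂ)⁻¹ • (phaseOp hm (1 / ((ns i : ℝ) + 1)) f
        - phaseOp hm 0 f) : Lp ℂ 2 μ) x) atTop (𝓝 (Complex.I * m x * f x)) :=
        h4.congr fun i => (h2 (ns i)).symm
      have h6 := tendsto_nhds_unique h1 h5
      rw [h3, Pi.smul_apply, smul_eq_mul, mul_assoc] at h6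
      exact mul_left_cancel₀ Complex.I_ne_zero h6
    · intro hg
      rw [← tendsto_sub_nhds_zero_iff]
      refine tendsto_zero_of_dominated_L2 (φ := fun t x =>
        ((t : ℂ)⁻¹ • (Complex.exp ((t * m x : ℝ) * Complex.I) - 1) - Complex.I * m x) * f x)
        ((2 : ℂ) • g) ?_ ?_ ?_
      · intro t
        filter_upwards [Lp.coeFn_sub ((t : ℂ)⁻¹ • (phaseOp hm t f - phaseOp hm 0 f))
          (Complex.I • g), hslope t, Lp.coeFn_smul Complex.I g, hg] with x h1 h2 h3 h4
        rw [h1, Pi.sub_apply, h2, h3, Pi.smul_apply, h4, sub_mul, mul_assoc Complex.I]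
        rfl
      · intro t
        filter_upwards [Lp.coeFn_smul (2 : ℂ) g, hg] with x hx h4
        rw [hx, Pi.smul_apply, h4, norm_smul, norm_mul, norm_mul (m x : ℂ), ← mul_assoc]
        gcongr
        refine (norm_sub_le _ _).trans ?_
        rw [norm_mul, Complex.norm_I, Complex.norm_real, norm_smul, one_mul, norm_inv,
          Complex.norm_real, Complex.norm_ofNat, two_mul]
        gcongr
        refine (mul_le_mul_of_nonneg_left (norm_phase_sub_one_le _)
          (by positivity)).trans ?_
        rw [abs_mul, ← mul_assoc, Real.norm_eq_abs, Real.norm_eq_abs]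
        exact mul_le_of_le_one_left (abs_nonneg _) inv_mul_le_one
      · refine Eventually.of_forall fun x => ?_
        have := (hpt x).sub_const (Complex.I * m x * f x)
        simpa [sub_mul] using this

theorem IsUnitaryGroupOf.expI_eq {H : Type*} [NormedAddCommGroup H] [InnerProductSpace ℂ H]
    [CompleteSpace H] {U : ℝ → H →L[ℂ] H} {A : H →ₗ.[ℂ] H}
    (hU : IsUnitaryGroupOf U A) (hA : Dense (A.domain : Set H)) : expI A = U := by
  have hex : ∃ U, IsUnitaryGroupOf U A := ⟨U, hU⟩
  rw [expI, dif_pos hex]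
  exact hex.choose_spec.unique hU hA

theorem IsMultiplicationBy.expI_eq {A : Lp ℂ 2 μ →ₗ.[ℂ] Lp ℂ 2 μ} {m : α → ℝ}
    (h : IsMultiplicationBy A m) (hm : Measurable m) : expI A = phaseOp hm :=
  (h.isUnitaryGroupOf hm).expI_eq (h.dense_domain hm)

end Multiplication

/-! ### The position operator and its cube -/

theorem mem_graph_opMul {H : Type*} [NormedAddCommGroup H] [InnerProductSpace ℂ H]
    {S T : H →ₗ.[ℂ] H} {f g : H} :
    (f, g) ∈ (opMul S T).graph ↔ ∃ h, (f, h) ∈ T.graph ∧ (h, g) ∈ S.graph := by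
  constructor
  · intro hfg
    obtain ⟨y, hy, hg⟩ := (LinearPMap.mem_graph_iff _).1 hfg
    obtain ⟨hyT, hyS⟩ := y.2
    refine ⟨T ⟨y, hyT⟩, ?_, ?_⟩
    · exact (LinearPMap.mem_graph_iff _).2 ⟨⟨y, hyT⟩, hy, rfl⟩
    · exact (LinearPMap.mem_graph_iff _).2 ⟨⟨_, hyS⟩, rfl, hg⟩
  · rintro ⟨h, h1, h2⟩
    obtain ⟨y, hy, rfl⟩ := (LinearPMap.mem_graph_iff _).1 h1
    obtain ⟨w, hw, rfl⟩ := (LinearPMap.mem_graph_iff _).1 h2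
    obtain ⟨w, hwS⟩ := w
    dsimp only at hy hw
    subst hy hw
    exact (LinearPMap.mem_graph_iff _).2 ⟨⟨y, y.2, hwS⟩, rfl, rfl⟩

theorem isMultiplicationBy_positionOp : IsMultiplicationBy positionOp (fun x => x) := by
  intro f g
  rw [LinearPMap.mem_graph_iff]
  constructor
  · rintro ⟨y, rfl, rfl⟩
    exact MemLp.coeFn_toLp y.2
  · intro hg
    have hf : MemLp (fun x : ℝ => (x : ℂ) * f x) 2 volume := (memLp_congr_ae hg).1 (Lp.memLp g)
    exact ⟨⟨f, hf⟩, rfl, Lp.ext ((MemLp.coeFn_toLp hf).trans hg.symm)⟩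

/-- If `f` and `x³ f` are square integrable, so are the intermediate functions `x f`, `x² f`: this
is why the natural domain of the cube is the maximal domain of multiplication by `x³`. -/
theorem memLp_pow_mul_of_cube {f g : L2R} (hg : g =ᵐ[volume] fun x => ((x ^ 3 : ℝ) : ℂ) * f x)
    {k : ℕ} (hk : k ≤ 3) : MemLp (fun x : ℝ => (x : ℂ) ^ k * f x) 2 volume := by
  refine ((Lp.memLp f).norm.add (Lp.memLp g).norm).of_le
    (Continuous.aestronglyMeasurable (by fun_prop) |>.mul (Lp.aestronglyMeasurable f)) ?_
  filter_upwards [hg] with x hx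
  have hnn : 0 ≤ ‖f x‖ + ‖g x‖ := by positivity
  rw [Pi.add_apply, Real.norm_of_nonneg hnn, hx, norm_mul, norm_mul, norm_pow, Complex.norm_real,
    Complex.norm_real, Real.norm_eq_abs, Real.norm_eq_abs, abs_pow]
  have hpow : |x| ^ k ≤ 1 + |x| ^ 3 := by
    rcases le_total |x| 1 with h | h
    · exact (pow_le_one₀ (abs_nonneg x) h).trans (le_add_of_nonneg_right (by positivity))
    · exact (pow_le_pow_right₀ h hk).trans (le_add_of_nonneg_left zero_le_one)
  calc |x| ^ k * ‖f x‖ ≤ (1 + |x| ^ 3) * ‖f x‖ := by gcongr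
    _ = ‖f x‖ + |x| ^ 3 * ‖f x‖ := by ring

theorem isMultiplicationBy_cube : IsMultiplicationBy (opCube positionOp) (fun x => x ^ 3) := by
  intro f g
  simp only [opCube, mem_graph_opMul, isMultiplicationBy_positionOp _ _]
  constructor
  · rintro ⟨h₂, ⟨h₁, e1, e2⟩, e3⟩
    filter_upwards [e1, e2, e3] with x e1 e2 e3
    rw [e3, e2, e1]
    push_cast
    ring
  · intro hg
    have m1 := memLp_pow_mul_of_cube hg (k := 1) (by norm_num)
    have m2 := memLp_pow_mul_of_cube hg (k := 2) (by norm_num)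
    refine ⟨m2.toLp _, ⟨m1.toLp _, ?_, ?_⟩, ?_⟩
    · filter_upwards [m1.coeFn_toLp] with x hx
      rw [hx, pow_one]
    · filter_upwards [m1.coeFn_toLp, m2.coeFn_toLp] with x h1 h2
      rw [h1, h2]
      ring
    · filter_upwards [m2.coeFn_toLp, hg] with x h2 hx
      rw [h2, hx]
      push_cast
      ring

/-! ### Characteristic functions in the Gaussian state -/

theorem conj_gaussianFun_mul_self (x : ℝ) :
    gaussianFun x * starRingEnd ℂ (gaussianFun x)
      = ((1 / √Real.pi : ℝ) : ℂ) * Complex.exp (-(x : ℂ) ^ 2) := by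
  have h : gaussianFun x * starRingEnd ℂ (gaussianFun x)
      = ((1 / √Real.pi * Real.exp (-x ^ 2) : ℝ) : ℂ) := by
    rw [gaussianFun, Complex.conj_ofReal, ← Complex.ofReal_mul, Complex.ofReal_inj]
    have hpi : 1 / √Real.pi = Real.pi ^ (-(1 / 2) : ℝ) := by
      rw [Real.sqrt_eq_rpow, Real.rpow_neg Real.pi_pos.le, one_div]
    rw [mul_mul_mul_comm, ← Real.rpow_add Real.pi_pos, ← Real.exp_add, hpi]
    congr 2 <;> ring
  rw [h]
  push_cast
  rfl

theorem IsMultiplicationBy.opCharFun_gaussianState {A : L2R →ₗ.[ℂ] L2R} {m : ℝ → ℝ}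
    (h : IsMultiplicationBy A m) (hm : Measurable m) (t : ℝ) :
    opCharFun A gaussianState t
      = (1 / √Real.pi : ℝ) * ∫ x : ℝ, Complex.exp (Complex.I * t * m x - x ^ 2) := by
  rw [opCharFun, h.expI_eq hm, L2.inner_def, ← integral_const_mul]
  refine integral_congr_ae ?_
  filter_upwards [coeFn_phaseOp hm t gaussianState, memLp_gaussianFun.coeFn_toLp] with x h1 h2
  rw [h1, gaussianState, h2, RCLike.inner_apply, mul_assoc, conj_gaussianFun_mul_self,
    mul_left_comm, ← Complex.exp_add]
  congr 2
  push_cast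
  ring

theorem integral_cexp_neg_sq :
    ((1 / √Real.pi : ℝ) : ℂ) * ∫ x : ℝ, Complex.exp (-(x : ℂ) ^ 2) = 1 := by
  have h : (fun x : ℝ => Complex.exp (-(x : ℂ) ^ 2)) = fun x => ((Real.exp (-1 * x ^ 2) : ℝ) : ℂ) := by
    ext x
    push_cast
    ring_nf
  rw [h, integral_complex_ofReal, integral_gaussian, ← Complex.ofReal_mul, div_one,
    one_div_mul_cancel (Real.sqrt_pos.2 Real.pi_pos).ne', Complex.ofReal_one]

theorem norm_gaussianState : ‖gaussianState‖ = 1 := by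
  have h : ((‖gaussianState‖ ^ 2 : ℝ) : ℂ) = 1 := by
    have h1 : ((‖gaussianState‖ ^ 2 : ℝ) : ℂ) = inner ℂ gaussianState gaussianState := by
      rw [inner_self_eq_norm_sq_to_K]; norm_cast
    rw [h1, L2.inner_def, ← integral_cexp_neg_sq, ← integral_const_mul]
    refine integral_congr_ae ?_
    filter_upwards [memLp_gaussianFun.coeFn_toLp] with x hx
    rw [gaussianState, hx, RCLike.inner_apply, conj_gaussianFun_mul_self]
  have h2 : ‖gaussianState‖ ^ 2 = 1 := by exact_mod_cast h
  exact (pow_eq_one_iff_of_nonneg (norm_nonneg _) two_ne_zero).1 h2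

theorem opCharFun_positionOp (t : ℝ) : opCharFun positionOp gaussianState t
    = charFun (ProbabilityTheory.gaussianReal 0 (1 / 2)) t := by
  rw [isMultiplicationBy_positionOp.opCharFun_gaussianState measurable_id, charFun_apply_real,
    ProbabilityTheory.integral_gaussianReal_eq_integral_smul (by norm_num), ← integral_const_mul]
  refine integral_congr_ae (Eventually.of_forall fun x => ?_)
  dsimp only
  have hv : (((1 / 2 : NNReal)) : ℝ) = 1 / 2 := by norm_num
  rw [ProbabilityTheory.gaussianPDFReal, hv, Complex.real_smul, sub_eq_add_neg, Complex.exp_add]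
  have h1 : 2 * Real.pi * (1 / 2) = Real.pi := by ring
  have h2 : -(x - 0) ^ 2 / (2 * (1 / 2)) = -x ^ 2 := by ring
  rw [h1, h2]
  push_cast
  ring_nf

/-! ### Deforming the contour to the path of steepest descent -/

/-- In the double sector `0 ≤ Im w ≤ |Re w| / √3` the integrand `exp (i t w³ - w²)` with `t ≥ 0`
decays like a Gaussian: the cubic term only helps, as `Im w³ ≥ 0` there. -/
theorem norm_cexp_cubic_le {t p q : ℝ} (ht : 0 ≤ t) (hq : 0 ≤ q) (hpq : 3 * q ^ 2 ≤ p ^ 2) :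
    ‖Complex.exp (Complex.I * t * (p + q * Complex.I) ^ 3 - (p + q * Complex.I) ^ 2)‖
      ≤ Real.exp (-(2 / 3) * p ^ 2) := by
  have hre : (Complex.I * t * (p + q * Complex.I) ^ 3 - (p + q * Complex.I) ^ 2).re
      = -(t * (q * (3 * p ^ 2 - q ^ 2))) - p ^ 2 + q ^ 2 := by
    simp [pow_succ]
    ring
  rw [Complex.norm_exp, hre, Real.exp_le_exp]
  have : 0 ≤ t * (q * (3 * p ^ 2 - q ^ 2)) :=
    mul_nonneg ht (mul_nonneg hq (by nlinarith [sq_nonneg p]))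
  nlinarith

theorem integrable_cexp_cubic (t : ℝ) :
    Integrable fun x : ℝ => Complex.exp (Complex.I * t * x ^ 3 - x ^ 2) := by
  refine (integrable_exp_neg_mul_sq one_pos).mono' (by fun_prop) (Eventually.of_forall fun x => ?_)
  have hre : (Complex.I * t * (x : ℂ) ^ 3 - (x : ℂ) ^ 2).re = -1 * x ^ 2 := by
    simp [pow_succ]
  rw [Complex.norm_exp, hre]

theorem tendsto_exp_neg_sq_mul_self {ι : Type*} {l : Filter ι} {p : ι → ℝ}
    (hp : Tendsto (fun i => |p i|) l atTop) :
    Tendsto (fun i => Real.exp (-(2 / 3) * p i ^ 2) * |p i|) l (𝓝 0) := by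
  have h := ((rpow_mul_exp_neg_mul_sq_isLittleO_exp_neg (b := 2 / 3) (by norm_num) 1).trans_tendsto
    ((Real.tendsto_exp_atBot.comp ((tendsto_id.const_mul_atTop_of_neg
      (by norm_num : -(1 / 2 : ℝ) < 0)))))).comp hp
  refine h.congr fun i => ?_
  simp only [Function.comp_apply, Real.rpow_one, sq_abs]
  ring

/-- The horizontal coordinate of the steepest-descent hyperbola with scale `a`. -/
noncomputable def hyperbolaRe (a s : ℝ) : ℝ := a * (√3 * Real.sinh s)

/-- The vertical coordinate of the steepest-descent hyperbola with scale `a`. -/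
noncomputable def hyperbolaIm (a s : ℝ) : ℝ := a * (Real.cosh s - 1)

/-- The hyperbola through the saddle point `0`, along which `i t x³ - x²` is real when `a = 1/(3t)`:
it is the image of the line `Im θ = π/6` under `θ ↦ 2 a sinh θ - i a`. -/
noncomputable def hyperbola (a s : ℝ) : ℂ := hyperbolaRe a s + hyperbolaIm a s * Complex.I

theorem hyperbolaIm_nonneg {a : ℝ} (ha : 0 ≤ a) (s : ℝ) : 0 ≤ hyperbolaIm a s :=
  mul_nonneg ha (sub_nonneg.2 (Real.one_le_cosh s))

/-- The hyperbola stays in the sector `0 ≤ Im w ≤ |Re w| / √3` where the integrand decays. -/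
theorem three_mul_hyperbolaIm_sq_le (a s : ℝ) :
    3 * hyperbolaIm a s ^ 2 ≤ hyperbolaRe a s ^ 2 := by
  have h3 : √3 ^ 2 = (3 : ℝ) := Real.sq_sqrt (by norm_num)
  have h : (Real.cosh s - 1) ^ 2 ≤ Real.sinh s ^ 2 := by
    nlinarith [Real.cosh_sq s, Real.one_le_cosh s]
  calc 3 * hyperbolaIm a s ^ 2 = 3 * a ^ 2 * (Real.cosh s - 1) ^ 2 := by rw [hyperbolaIm]; ring
    _ ≤ 3 * a ^ 2 * Real.sinh s ^ 2 := by gcongr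
    _ = hyperbolaRe a s ^ 2 := by rw [hyperbolaRe, mul_pow, mul_pow, h3]; ring

theorem hasDerivAt_hyperbola (a s : ℝ) :
    HasDerivAt (hyperbola a)
      (a * (√3 * Real.cosh s) + a * Real.sinh s * Complex.I : ℂ) s := by
  have h1 := (((Real.hasDerivAt_sinh s).const_mul √3).const_mul a).ofReal_comp
  have h2 := ((((Real.hasDerivAt_cosh s).sub_const 1).const_mul a).ofReal_comp).mul_const Complex.I
  have h : HasDerivAt (hyperbola a) _ s := h1.add h2
  refine h.congr_deriv ?_
  push_cast
  ring

/-- Along the hyperbola the phase is real: with `w = 2 a sinh θ - i a` the cubic polynomial becomes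
a multiple of `1 + i sinh (3 θ)`, by the triple-angle formula, and `θ = s + i π / 6`. -/
theorem cubic_hyperbola {t : ℝ} (ht : t ≠ 0) (s : ℝ) :
    Complex.I * t * hyperbola (1 / (3 * t)) s ^ 3 - hyperbola (1 / (3 * t)) s ^ 2
      = ((2 / (27 * t ^ 2) * (1 - Real.cosh (3 * s)) : ℝ) : ℂ) := by
  have h3 : (√3 : ℂ) ^ 2 = 3 := by
    rw [← Complex.ofReal_pow, Real.sq_sqrt (by norm_num)]; norm_num
  have hC : Complex.cosh s ^ 2 = Complex.sinh s ^ 2 + 1 := Complex.cosh_sq s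
  have hI := Complex.I_sq
  have ht' : (t : ℂ) ≠ 0 := Complex.ofReal_ne_zero.2 ht
  rw [Real.cosh_three_mul]
  unfold hyperbola hyperbolaRe hyperbolaIm
  push_cast
  generalize (√3 : ℂ) = r at *
  generalize Complex.cosh s = C at *
  generalize Complex.sinh s = S at *
  generalize Complex.I = i at *
  have key : i * (r * S + (C - 1) * i) ^ 3 / 3 - (r * S + (C - 1) * i) ^ 2
      = 2 / 3 * (1 - (4 * C ^ 3 - 3 * C)) := by
    grind
  have e : i * t * (1 / (3 * t) * (r * S) + 1 / (3 * t) * (C - 1) * i) ^ 3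
      - (1 / (3 * t) * (r * S) + 1 / (3 * t) * (C - 1) * i) ^ 2
      = 1 / (9 * t ^ 2) * (i * (r * S + (C - 1) * i) ^ 3 / 3 - (r * S + (C - 1) * i) ^ 2) := by
    field_simp
    ring
  rw [e, key]
  field_simp
  ring

/-- Cauchy's theorem: the real line may be deformed into the hyperbola, since the integrand
decays like a Gaussian in the region between them. -/
theorem integral_cexp_cubic_eq_hyperbola {t : ℝ} (ht : 0 ≤ t) {a : ℝ} (ha : 0 < a)
    (hint : Integrable fun s : ℝ =>
      Complex.exp (Complex.I * t * hyperbola a s ^ 3 - hyperbola a s ^ 2) *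
        (a * (√3 * Real.cosh s) + a * Real.sinh s * Complex.I : ℂ)) :
    ∫ x : ℝ, Complex.exp (Complex.I * t * x ^ 3 - x ^ 2) = ∫ s : ℝ,
      Complex.exp (Complex.I * t * hyperbola a s ^ 3 - hyperbola a s ^ 2) *
        (a * (√3 * Real.cosh s) + a * Real.sinh s * Complex.I : ℂ) := by
  set f : ℂ → ℂ := fun w => Complex.exp (Complex.I * t * w ^ 3 - w ^ 2) with hf
  have hfd : Differentiable ℂ f := by fun_prop
  obtain ⟨F, hF⟩ := hfd.isExactOn_univ
  replace hF : ∀ w, HasDerivAt F (f w) w := fun w => hF w trivial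
  have hline : ∀ R : ℝ, ∫ x in hyperbolaRe a (-R)..hyperbolaRe a R, f x
      = F (hyperbolaRe a R) - F (hyperbolaRe a (-R)) := fun R =>
    intervalIntegral.integral_eq_sub_of_hasDerivAt
      (f := fun x : ℝ => F x) (fun x _ => (hF x).comp_ofReal)
      ((hfd.continuous.comp Complex.continuous_ofReal).intervalIntegrable _ _)
  have hcurve : ∀ R : ℝ, ∫ s in (-R)..R,
      f (hyperbola a s) * (a * (√3 * Real.cosh s) + a * Real.sinh s * Complex.I : ℂ)
      = F (hyperbola a R) - F (hyperbola a (-R)) := fun R =>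
    intervalIntegral.integral_eq_sub_of_hasDerivAt
      (f := fun s => F (hyperbola a s))
      (fun s _ => (hF _).comp s (hasDerivAt_hyperbola a s))
      hint.intervalIntegrable
  -- the vertical segment joining the two contours contributes nothing in the limit
  have hseg : ∀ s, ‖F (hyperbola a s) - F (hyperbolaRe a s)‖
      ≤ Real.exp (-(2 / 3) * hyperbolaRe a s ^ 2) * |hyperbolaRe a s| := by
    intro s
    have hq := hyperbolaIm_nonneg ha.le s
    have hpq := three_mul_hyperbolaIm_sq_le a s
    have hbd := norm_image_sub_le_of_norm_deriv_le_segment'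
      (f := fun y : ℝ => F (hyperbolaRe a s + y * Complex.I))
      (f' := fun y => f (hyperbolaRe a s + y * Complex.I) * Complex.I)
      (C := Real.exp (-(2 / 3) * hyperbolaRe a s ^ 2)) (a := 0) (b := hyperbolaIm a s)
      (fun y _ => by
        have h1 : HasDerivAt (fun y : ℝ => (hyperbolaRe a s + y * Complex.I : ℂ)) Complex.I y := by
          simpa using ((Complex.ofRealCLM.hasDerivAt (x := y)).mul_const Complex.I).const_add
            (hyperbolaRe a s : ℂ)
        exact ((hF _).comp y h1).hasDerivWithinAt)
      (fun y hy => by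
        rw [norm_mul, Complex.norm_I, mul_one]
        refine norm_cexp_cubic_le ht hy.1 (le_trans ?_ hpq)
        have := pow_le_pow_left₀ hy.1 hy.2.le 2
        linarith)
      (hyperbolaIm a s) (Set.right_mem_Icc.2 hq)
    have hqp : hyperbolaIm a s ≤ |hyperbolaRe a s| :=
      abs_le_of_sq_le_sq' (by rw [sq_abs]; nlinarith [sq_nonneg (hyperbolaIm a s)])
        (abs_nonneg _) |>.2
    simp only [Complex.ofReal_zero, zero_mul, add_zero, sub_zero] at hbd
    exact hbd.trans (by gcongr)
  have htop : Tendsto (hyperbolaRe a) atTop atTop := by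
    have hsinh : Tendsto Real.sinh atTop atTop :=
      tendsto_atTop_mono' _ ((eventually_ge_atTop 0).mono fun s hs => Real.self_le_sinh_iff.2 hs)
        tendsto_id
    exact (hsinh.const_mul_atTop (by positivity)).const_mul_atTop ha
  have hneg : ∀ s, hyperbolaRe a (-s) = -hyperbolaRe a s := fun s => by
    simp [hyperbolaRe]
  have hlim : Tendsto (fun s => F (hyperbola a s) - F (hyperbolaRe a s)) atTop (𝓝 0) :=
    squeeze_zero_norm hseg (tendsto_exp_neg_sq_mul_self (tendsto_abs_atTop_atTop.comp htop))
  have hlim' : Tendsto (fun s => F (hyperbola a (-s)) - F (hyperbolaRe a (-s))) atTop (𝓝 0) := by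
    refine squeeze_zero_norm (fun s => hseg (-s)) (tendsto_exp_neg_sq_mul_self ?_)
    simp only [hneg, abs_neg]
    exact tendsto_abs_atTop_atTop.comp htop
  have h1 : Tendsto (fun R => ∫ x in hyperbolaRe a (-R)..hyperbolaRe a R, f x) atTop
      (𝓝 (∫ x : ℝ, f x)) :=
    intervalIntegral_tendsto_integral (integrable_cexp_cubic t)
      (by simp only [hneg]; exact tendsto_neg_atTop_atBot.comp htop) htop
  have h2 := intervalIntegral_tendsto_integral hint tendsto_neg_atTop_atBot tendsto_id
  refine tendsto_nhds_unique h1 (h2.congr_dist ?_) |>.trans rfl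
  have h3 := (hlim.sub hlim').norm
  simp only [sub_zero, norm_zero] at h3
  refine h3.congr fun R => ?_
  rw [hline, dist_eq_norm]
  simp only [id]
  rw [hcurve]
  congr 1
  ring

/-! ### Evaluation by the Bessel function -/

/-- The integrand is dominated by a Gaussian: half of the exponent absorbs the factor `cosh s`, and
`cosh (3 s) ≥ 9 s² / 2` takes care of the rest. -/
theorem integrable_exp_neg_cosh_mul_cosh {z : ℝ} (hz : 0 < z) :
    Integrable fun s : ℝ => Real.exp (-z * Real.cosh (3 * s)) * Real.cosh s := by
  refine ((integrable_exp_neg_mul_sq (b := 9 * z / 4) (by positivity)).const_mul (2 / z)).mono'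
    (by fun_prop) (Eventually.of_forall fun s => ?_)
  have h1 : Real.cosh s ≤ Real.cosh (3 * s) := by
    rw [Real.cosh_le_cosh, abs_mul]
    norm_num
    linarith [abs_nonneg s]
  have h2 : 9 / 2 * s ^ 2 ≤ Real.cosh (3 * s) := by
    have e : Real.cosh (3 * s) = 1 + 2 * Real.sinh (3 * s / 2) ^ 2 := by
      have := Real.cosh_two_mul (3 * s / 2)
      rw [Real.cosh_sq, mul_div_cancel₀ _ two_ne_zero] at this
      rw [this]; ring
    have h : (3 * s / 2) ^ 2 ≤ Real.sinh (3 * s / 2) ^ 2 := by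
      rw [sq_le_sq]
      rcases le_total 0 (3 * s / 2) with h | h
      · rw [abs_of_nonneg h, abs_of_nonneg (Real.sinh_nonneg_iff.2 h)]
        exact Real.self_le_sinh_iff.2 h
      · rw [abs_of_nonpos h, abs_of_nonpos (Real.sinh_nonpos_iff.2 h)]
        exact neg_le_neg (Real.sinh_le_self_iff.2 h)
    rw [e]
    nlinarith
  have h3 : z / 2 * Real.cosh (3 * s) ≤ Real.exp (z / 2 * Real.cosh (3 * s)) :=
    (le_add_of_nonneg_right zero_le_one).trans (Real.add_one_le_exp _)
  rw [Real.norm_eq_abs, abs_of_pos (mul_pos (Real.exp_pos _) (Real.cosh_pos _))]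
  have h4 : Real.cosh s ≤ 2 / z * Real.exp (z / 2 * Real.cosh (3 * s)) := by
    rw [div_mul_eq_mul_div, le_div_iff₀ hz]
    nlinarith
  calc Real.exp (-z * Real.cosh (3 * s)) * Real.cosh s
      ≤ Real.exp (-z * Real.cosh (3 * s)) * (2 / z * Real.exp (z / 2 * Real.cosh (3 * s))) := by
        gcongr
    _ = 2 / z * Real.exp (-(z / 2) * Real.cosh (3 * s)) := by
        rw [mul_left_comm, ← Real.exp_add]
        ring_nf
    _ ≤ 2 / z * Real.exp (-(9 * z / 4) * s ^ 2) := by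
        refine mul_le_mul_of_nonneg_left (Real.exp_le_exp.2 ?_) (by positivity)
        nlinarith

theorem integrable_exp_neg_cosh_mul_sinh {z : ℝ} (hz : 0 < z) :
    Integrable fun s : ℝ => Real.exp (-z * Real.cosh (3 * s)) * Real.sinh s := by
  refine (integrable_exp_neg_cosh_mul_cosh hz).mono' (by fun_prop) (Eventually.of_forall fun s => ?_)
  rw [norm_mul, Real.norm_eq_abs, Real.abs_exp, Real.norm_eq_abs]
  gcongr
  exact abs_le.2 ⟨by linarith [Real.cosh_add_sinh s, Real.exp_pos s], (Real.sinh_lt_cosh s).le⟩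

theorem integral_exp_neg_cosh_mul_sinh (z : ℝ) :
    ∫ s : ℝ, Real.exp (-z * Real.cosh (3 * s)) * Real.sinh s = 0 := by
  have h := integral_neg_eq_self (fun s : ℝ => Real.exp (-z * Real.cosh (3 * s)) * Real.sinh s)
    volume
  simp only [mul_neg, Real.cosh_neg, Real.sinh_neg, integral_neg] at h
  linarith

theorem integral_exp_neg_cosh_mul_cosh (z : ℝ) :
    ∫ s : ℝ, Real.exp (-z * Real.cosh (3 * s)) * Real.cosh s = 2 / 3 * besselK (1 / 3) z := by
  have h := integral_comp_abs (f := fun s : ℝ => Real.exp (-z * Real.cosh (3 * s)) * Real.cosh s)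
  have hs : ∀ s : ℝ, Real.cosh (3 * |s|) = Real.cosh (3 * s) := fun s => by
    rw [← Real.cosh_abs (3 * s), abs_mul, abs_of_pos (by norm_num : (0 : ℝ) < 3)]
  simp only [Real.cosh_abs, hs] at h
  have h' := integral_comp_mul_left_Ioi
    (fun u : ℝ => Real.exp (-z * Real.cosh u) * Real.cosh (1 / 3 * u)) 0
    (by norm_num : (0 : ℝ) < 3)
  have e : ∀ s : ℝ, 1 / 3 * (3 * s) = s := fun s => by ring
  simp only [e, mul_zero, smul_eq_mul] at h'
  rw [h, h', besselK]
  ring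

theorem integral_cexp_cubic_of_pos {t : ℝ} (ht : 0 < t) :
    (1 / √Real.pi : ℝ) * ∫ x : ℝ, Complex.exp (Complex.I * t * x ^ 3 - x ^ 2)
      = (cubeCharFun t : ℂ) := by
  set z := 2 / (27 * t ^ 2) with hz
  set a := 1 / (3 * t) with ha
  have hz0 : 0 < z := by positivity
  have hcos := integrable_exp_neg_cosh_mul_cosh hz0
  have hsin := integrable_exp_neg_cosh_mul_sinh hz0
  have hfun : (fun s : ℝ =>
      Complex.exp (Complex.I * t * hyperbola a s ^ 3 - hyperbola a s ^ 2) *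
        (a * (√3 * Real.cosh s) + a * Real.sinh s * Complex.I : ℂ)) = fun s : ℝ =>
      ((Real.exp z * a * √3 : ℝ) : ℂ) * ((Real.exp (-z * Real.cosh (3 * s)) * Real.cosh s : ℝ) : ℂ)
        + (Real.exp z * a * Complex.I : ℂ)
          * ((Real.exp (-z * Real.cosh (3 * s)) * Real.sinh s : ℝ) : ℂ) := by
    ext s
    rw [ha, cubic_hyperbola ht.ne', ← ha, ← hz, mul_sub, mul_one, sub_eq_add_neg, ← neg_mul,
      ← Complex.ofReal_exp, Real.exp_add]
    push_cast
    ring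
  have i1 : Integrable fun s : ℝ => ((Real.exp z * a * √3 : ℝ) : ℂ) *
      ((Real.exp (-z * Real.cosh (3 * s)) * Real.cosh s : ℝ) : ℂ) := hcos.ofReal.const_mul _
  have i2 : Integrable fun s : ℝ => (Real.exp z * a * Complex.I : ℂ) *
      ((Real.exp (-z * Real.cosh (3 * s)) * Real.sinh s : ℝ) : ℂ) := hsin.ofReal.const_mul _
  rw [integral_cexp_cubic_eq_hyperbola ht.le (by positivity : 0 < a) (by
    rw [hfun]; exact i1.add i2), hfun]
  rw [integral_add i1 i2, integral_const_mul, integral_const_mul, integral_complex_ofReal,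
    integral_complex_ofReal, integral_exp_neg_cosh_mul_sinh, integral_exp_neg_cosh_mul_cosh, cubeCharFun, if_neg ht.ne',
    abs_of_pos ht, ← hz, Complex.ofReal_zero, mul_zero, add_zero, ← Complex.ofReal_mul,
    ← Complex.ofReal_mul, Complex.ofReal_inj, Real.sqrt_mul (by norm_num), ha]
  have h3 : √3 * √3 = (3 : ℝ) := Real.mul_self_sqrt (by norm_num)
  have h3' : √(3 : ℝ) ≠ 0 := by positivity
  have hpi : √Real.pi ≠ 0 := (Real.sqrt_pos.2 Real.pi_pos).ne'
  field_simp
  rw [sq, h3]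

theorem integral_cexp_cubic (t : ℝ) :
    (1 / √Real.pi : ℝ) * ∫ x : ℝ, Complex.exp (Complex.I * t * x ^ 3 - x ^ 2)
      = (cubeCharFun t : ℂ) := by
  rcases lt_trichotomy t 0 with ht | rfl | ht
  · have heven : cubeCharFun (-t) = cubeCharFun t := by simp [cubeCharFun]
    rw [← heven, ← integral_cexp_cubic_of_pos (neg_pos.2 ht), ← integral_neg_eq_self]
    congr 2
    ext x
    push_cast
    ring_nf
  · simpa [cubeCharFun] using integral_cexp_neg_sq
  · exact integral_cexp_cubic_of_pos ht

theorem theorem2p1 :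
    -- `X` and `X³` are self-adjoint, so `e^{itX}` and `e^{itX³}` exist, and `Φ` is a unit vector
    (IsSelfAdjoint positionOp ∧ IsSelfAdjoint (opCube positionOp) ∧
      IsUnitaryGroupOf (expI positionOp) positionOp ∧
      IsUnitaryGroupOf (expI (opCube positionOp)) (opCube positionOp) ∧
      ‖gaussianState‖ = 1) ∧
    -- `X` has the distribution `N(0, 1/2)` in the state `Φ`
    (∀ t : ℝ, opCharFun positionOp gaussianState t
      = charFun (ProbabilityTheory.gaussianReal 0 (1 / 2)) t) ∧
    -- the characteristic function of `X³` in the state `Φ`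
    (∀ t : ℝ, opCharFun (opCube positionOp) gaussianState t = (cubeCharFun t : ℂ)) ∧
    -- the integral identity
    (∀ t : ℝ, (1 / √Real.pi : ℝ) * ∫ x : ℝ, Complex.exp (Complex.I * t * x ^ 3 - x ^ 2)
      = (cubeCharFun t : ℂ)) := by
  have hm : Measurable fun x : ℝ => x ^ 3 := by fun_prop
  refine ⟨⟨isMultiplicationBy_positionOp.isSelfAdjoint measurable_id,
    isMultiplicationBy_cube.isSelfAdjoint hm, ?_, ?_, norm_gaussianState⟩,
    opCharFun_positionOp, fun t => ?_, integral_cexp_cubic⟩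
  · rw [isMultiplicationBy_positionOp.expI_eq measurable_id]
    exact isMultiplicationBy_positionOp.isUnitaryGroupOf measurable_id
  · rw [isMultiplicationBy_cube.expI_eq hm]
    exact isMultiplicationBy_cube.isUnitaryGroupOf hm
  · rw [isMultiplicationBy_cube.opCharFun_gaussianState hm, ← integral_cexp_cubic]
    push_cast
    rfl
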